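/- **Setting.** A *stochastic transition system* (STS) is a measurable space $(S,\Sigma)$ with a Markov kernel $\kappa$ on it; $\mathrm{Prob}_\mu$ is the law of its runs $s_0s_1\dots$ with $s_0\sim\mu$ and $s_{k+1}\sim\kappa(s_k,\cdot)$, and $\mathbf F B$ is the event that some $s_k$ lies in $B$. Put $\widetilde B=\{s\mid \mathrm{Prob}_{\delta_s}(\mathbf F B)=0\}$ and $\mathrm{Pre}(A)=\{s\mid\kappa(s,A)>0\}$. The STS is *decisive* w.r.t. $B\in\Sigma$ if $\mathrm{Prob}_\mu(\mathbf F B\vee\mathbf F\widetilde B)=1$ for every initial distribution $\mu$. Let $(S_1,\Sigma_1,\kappa_1)$ and $(S_2,\Sigma_2,\kappa_2)$ be STSs and $\alpha:S_1\to S_2$ measurable. The second is an *$\alpha$-abstraction* of the first if for every probability measure $\mu$ on $S_1$ and every $A\in\Sigma_2$, the image under $\alpha$ of $\mu\kappa_1$ gives $A$ positive measure if and only if $(\alpha_\#\mu)\kappa_2$ does. It is *compatible* with $B\in\Sigma_1$ if $\alpha^{-1}(\alpha(B))=B$. It is *sound* if for all $\mu$ and $A\in\Sigma_2$, $\mathrm{Prob}^{2}_{\alpha_\#\mu}(\mathbf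 F A)=1$ implies $\mathrm{Prob}^{1}_{\mu}(\mathbf F\,\alpha^{-1}(A))=1$. A *stochastic hybrid system* (SHS) $\mathcal H$ consists of a finite set $L$ of locations, a number $n$ of real variables, a set of events $A$, a finite set $E\subseteq L\times A\times L$ of edges, a continuous dynamics $\gamma_\ell:\mathbb R^n\times\mathbb R^+\to\mathbb R^n$ and an invariant $\mathrm{Inv}(\ell)\subseteq\mathbb R^n$ for every $\ell\in L$, a guard $\mathcal G(e)\subseteq\mathbb R^n$ and reset sets $\mathcal R_e(v)\subseteq\mathbb R^n$ for every $e\in E$ and $v\in\mathbb R^n$, and the following probability distributions, which depend measurably on the state or valuation: * for every state $s=(\ell,v)\in S_{\mathcal H}=L\times\mathbb R^n$, a distribution $\mu_s$ of time delays on $\mathbb R^+$ such that for $\mu_s$-almost every $\tau$, $\gamma_\ell(v,\tau')\in\mathrm{Inv}(\ell)$ for all $0\le\tau'\le\tau$ and $\gamma_\ell(v,\tau)\in\mathcal G(e)$ for some edge $e$ leaving $\ell$; * for every state $s$, a distribution $p_s$ on $E$; if some edge is enabled in $s$, then $p_s(e)>0$ if and only if $e$ is enabled in $s$, where $e$ is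 enabled in $(\ell,v)$ if it leaves $\ell$ and $v\in\mathrm{Inv}(\ell)\cap\mathcal G(e)$; * for every $e\in E$ and $v\in\mathbb R^n$, a distribution $\eta_e(v)$ on $\mathbb R^n$, with $\eta_e(v)(\mathcal R_e(v))=1$ if $v\in\mathcal G(e)$. Its semantics is the STS $\mathcal T_{\mathcal H}$ on $S_{\mathcal H}$ with $$\kappa_{\mathcal H}((\ell,v),C)=\int_{\mathbb R^+}\sum_{e=(\ell,a,\ell')\in E}p_{(\ell,\gamma_\ell(v,\tau))}(e)\int_{\mathbb R^n}\mathbf 1_C(\ell',v')\,\mathrm d\big(\eta_e(\gamma_\ell(v,\tau))\big)(v')\,\mathrm d\mu_{(\ell,v)}(\tau).$$ An edge $e$ is *strongly reset* if $\eta_e(v)$ is the same distribution for all $v\in\mathcal G(e)$, and $\mathcal H$ is *cycle-reset* if every cycle of the graph $(L,E)$ contains a strongly reset edge. *Partition refinement*: as long as the current finite partition $\mathcal P$ of $S_{\mathcal H}$ has cells $P,P'$ with $P\cap\mathrm{Pre}(P')\ne\emptyset$ and $P\setminus\mathrm{Pre}(P')\ne\emptyset$, choose such a pair and replace $P$ by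 $P\cap\mathrm{Pre}(P')$ and $P\setminus\mathrm{Pre}(P')$; stop when there is no such pair and output $\mathcal P$. **Proposition.** Let $\mathcal H$ be a cycle-reset SHS and let $B\subseteq S_{\mathcal H}$ be measurable. Then $\mathcal T_{\mathcal H}$ is decisive w.r.t. every measurable set of states. Partition refinement, started on the partition formed by the nonempty sets among $B\cap(\{\ell\}\times\mathbb R^n)$ and $B^c\cap(\{\ell\}\times\mathbb R^n)$, $\ell\in L$, terminates whatever pairs are chosen. Every output is a finite partition $\mathcal P$ of $S_{\mathcal H}$ into measurable sets with the following property. Let $\alpha:S_{\mathcal H}\to\mathcal P$ map each state to its cell. Then $\alpha^{-1}(\alpha(B))=B$; there are Markov chains on $\mathcal P$ in which the transition from $P$ to $P'$ has positive probability if and only if $P\subseteq\mathrm{Pre}(P')$; and every such Markov chain is a sound $\alpha$-abstraction of $\mathcal T_{\mathcal H}$ compatible with $B$. In particular, $\mathcal H$ admits a finite, sound $\alpha$-abstraction compatible with $B$. -/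

import Mathlib

open MeasureTheory ProbabilityTheory Set
open scoped ENNReal NNReal

/-! ### Stochastic transition systems

A stochastic transition system (STS) is a measurable space `S` of states together with a
Markov kernel `κ : Kernel S S`. -/

namespace STS

section Basic

variable {S : Type*} [MeasurableSpace S]

/-- The law of the infinite run `s₀ s₁ s₂ …` of the STS `κ` when `s₀` is drawn from `μ`
and, for every `k`, the state `s_{k+1}` is drawn from `κ s_k`. -/
noncomputable def runLaw (κ : Kernel S S) [IsMarkovKernel κ] (μ : Measure S)
    [IsProbabilityMeasure μ] : Measure (ℕ → S) :=
  Kernel.trajMeasure (X := fun _ => S) μ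
    (fun k => κ.comap (fun x : (i : Finset.Iic k) → S => x ⟨k, Finset.mem_Iic.2 le_rfl⟩)
      (measurable_pi_apply _))

/-- The set of runs that visit `B` (the event `F B`). -/
def reach (B : Set S) : Set (ℕ → S) := {ρ | ∃ k, ρ k ∈ B}

/-- The set of states from which `B` is reached with probability `0`. -/
def avoid (κ : Kernel S S) [IsMarkovKernel κ] (B : Set S) : Set S :=
  {s | runLaw κ (Measure.dirac s) (reach B) = 0}

/-- `κ` is decisive w.r.t. `B`: from every initial distribution, almost surely `B` is visited or
a state is visited from which `B` is almost surely never reached. -/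
def Decisive (κ : Kernel S S) [IsMarkovKernel κ] (B : Set S) : Prop :=
  ∀ (μ : Measure S) [IsProbabilityMeasure μ],
    runLaw κ μ (reach B ∪ reach (avoid κ B)) = 1

/-- The set of states with a positive probability to be in `A` after one step. -/
def pre (κ : Kernel S S) (A : Set S) : Set S := {s | 0 < κ s A}

end Basic

section Abstraction

variable {S₁ S₂ : Type*} [MeasurableSpace S₁] [MeasurableSpace S₂]

/-- `κ₂` is an `α`-abstraction of `κ₁`: for every initial distribution `μ`, the image under `α` of
the law of `κ₁` after one step from `μ` has the same null sets as the law of `κ₂` after one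
step from the image of `μ`. -/
def IsAbstraction (κ₁ : Kernel S₁ S₁) (κ₂ : Kernel S₂ S₂) (α : S₁ → S₂) : Prop :=
  Measurable α ∧
    ∀ (μ : Measure S₁) [IsProbabilityMeasure μ] (A : Set S₂), MeasurableSet A →
      (0 < ((μ.bind κ₁).map α) A ↔ 0 < ((μ.map α).bind κ₂) A)

/-- `B` is `α`-closed; one also says that an `α`-abstraction is compatible with `B`. -/
def IsClosedUnder (α : S₁ → S₂) (B : Set S₁) : Prop := α ⁻¹' (α '' B) = B

/-- Soundness of an `α`-abstraction: sets that are almost surely reached in the abstraction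
`κ₂` are almost surely reached in `κ₁`. -/
def IsSound (κ₁ : Kernel S₁ S₁) [IsMarkovKernel κ₁] (κ₂ : Kernel S₂ S₂) [IsMarkovKernel κ₂]
    (α : S₁ → S₂) : Prop :=
  ∀ (μ : Measure S₁) (ν : Measure S₂) [IsProbabilityMeasure μ] [IsProbabilityMeasure ν],
    ν = μ.map α → ∀ A : Set S₂, MeasurableSet A →
      runLaw κ₂ ν (reach A) = 1 → runLaw κ₁ μ (reach (α ⁻¹' A)) = 1

end Abstraction

section Refinement

variable {S : Type*} [MeasurableSpace S]

/-- One iteration of the partition-refinement procedure: some cell `P` meets both `pre κ P'` and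
its complement for some cell `P'`, and it is replaced by these two parts. -/
def RefineStep (κ : Kernel S S) (𝒞 𝒟 : Set (Set S)) : Prop :=
  ∃ P ∈ 𝒞, ∃ P' ∈ 𝒞, (P ∩ pre κ P').Nonempty ∧ (P \ pre κ P').Nonempty ∧
    𝒟 = (𝒞 \ {P}) ∪ {P ∩ pre κ P', P \ pre κ P'}

/-- `𝒞` is the result of a complete execution of the procedure started on `𝒞₀`: it is reached by
finitely many iterations, and no further iteration is possible. -/
def IsRefinementOutput (κ : Kernel S S) (𝒞₀ 𝒞 : Set (Set S)) : Prop :=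
  Relation.ReflTransGen (RefineStep κ) 𝒞₀ 𝒞 ∧ ∀ 𝒟, ¬ RefineStep κ 𝒞 𝒟

/-- The cells of `𝒞`, as a discrete measurable space. -/
def Cells (𝒞 : Set (Set S)) : Type _ := {P : Set S // P ∈ 𝒞}

instance (𝒞 : Set (Set S)) : MeasurableSpace (Cells 𝒞) := ⊤

instance (𝒞 : Set (Set S)) : DiscreteMeasurableSpace (Cells 𝒞) := ⟨fun _ => trivial⟩

/-- `κ₂` is a Markov chain on the cells of `𝒞` whose transitions of positive probability are
exactly those from a cell `P` to a cell `P'` with `P ⊆ pre κ P'`. -/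
def IsQuotientChain (κ : Kernel S S) {𝒞 : Set (Set S)} (κ₂ : Kernel (Cells 𝒞) (Cells 𝒞)) : Prop :=
  ∀ P P' : Cells 𝒞, 0 < κ₂ P {P'} ↔ P.1 ⊆ pre κ P'.1

end Refinement

end STS

/-! ### Stochastic hybrid systems -/

/-- A stochastic hybrid system with finite set of locations `Loc`, alphabet of events `Event` and
`n` real variables. Its states are the pairs of a location and a valuation. -/
structure SHS (Loc Event : Type*) [MeasurableSpace Loc] (n : ℕ) where
  /-- the finite set of edges: (source, event, target) -/
  edges : Finset (Loc × Event × Loc)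
  /-- the continuous dynamics: `flow ℓ (v, τ)` is the valuation obtained from `v` when time `τ`
  elapses in location `ℓ` -/
  flow : Loc → (Fin n → ℝ) × ℝ≥0 → (Fin n → ℝ)
  continuous_flow : ∀ ℓ, Continuous (flow ℓ)
  /-- the invariants -/
  inv : Loc → Set (Fin n → ℝ)
  /-- the guards -/
  guard : edges → Set (Fin n → ℝ)
  /-- the sets of possible valuations after taking an edge from a valuation -/
  resetSet : edges → (Fin n → ℝ) → Set (Fin n → ℝ)
  /-- the distribution of the time delay in each state -/
  delay : Kernel (Loc × (Fin n → ℝ)) ℝ≥0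
  [isMarkov_delay : IsMarkovKernel delay]
  /-- the delay is almost surely one after which some edge is enabled, the invariant having been
  satisfied in the meantime -/
  delay_mem : ∀ s, ∀ᵐ τ ∂(delay s), (∀ τ' ≤ τ, flow s.1 (s.2, τ') ∈ inv s.1) ∧
    ∃ e : edges, e.1.1 = s.1 ∧ flow s.1 (s.2, τ) ∈ guard e
  /-- the distribution of the new valuation when an edge is taken from a valuation -/
  reset : edges → Kernel (Fin n → ℝ) (Fin n → ℝ)
  [isMarkov_reset : ∀ e, IsMarkovKernel (reset e)]
  reset_mem : ∀ e, ∀ v ∈ guard e, ∀ᵐ w ∂(reset e v), w ∈ resetSet e v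
  /-- the distribution on the edges in each state -/
  edgeProb : Loc × (Fin n → ℝ) → edges → ℝ≥0∞
  measurable_edgeProb : ∀ e, Measurable fun s => edgeProb s e
  sum_edgeProb : ∀ s, ∑ e, edgeProb s e = 1
  /-- in a state where some edge is enabled, the edges of positive probability are exactly the
  enabled ones -/
  edgeProb_pos_iff : ∀ s : Loc × (Fin n → ℝ), s.2 ∈ inv s.1 →
    (∃ e : edges, e.1.1 = s.1 ∧ s.2 ∈ guard e) →
    ∀ e : edges, 0 < edgeProb s e ↔ (e.1.1 = s.1 ∧ s.2 ∈ guard e)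

namespace SHS

variable {Loc Event : Type*} [MeasurableSpace Loc] {n : ℕ}

attribute [instance] SHS.isMarkov_delay SHS.isMarkov_reset

/-- The states. -/
abbrev State (_H : SHS Loc Event n) : Type _ := Loc × (Fin n → ℝ)

/-- The source of an edge. -/
def src (H : SHS Loc Event n) (e : H.edges) : Loc := e.1.1

/-- The target of an edge. -/
def tgt (H : SHS Loc Event n) (e : H.edges) : Loc := e.1.2.2

/-- The state after a delay, without changing the location. -/
def shift (H : SHS Loc Event n) (p : H.State × ℝ≥0) : H.State :=
  (p.1.1, H.flow p.1.1 (p.1.2, p.2))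

/-- The law of the new state when an edge is chosen and taken immediately. -/
noncomputable def jump (H : SHS Loc Event n) : Kernel H.State H.State where
  toFun s := ∑ e, H.edgeProb s e • (H.reset e s.2).map (Prod.mk (H.tgt e))
  measurable' := by
    refine Measure.measurable_of_measurable_coe _ fun A hA => ?_
    simp only [Measure.coe_finsetSum, Finset.sum_apply, Measure.smul_apply, smul_eq_mul]
    refine Finset.measurable_sum _ fun e _ => (H.measurable_edgeProb e).mul ?_
    have h : MeasurableSet (Prod.mk (H.tgt e) ⁻¹' A : Set (Fin n → ℝ)) := measurable_prodMk_left hA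
    simp only [Measure.map_apply measurable_prodMk_left hA]
    exact ((H.reset e).measurable_coe h).comp measurable_snd

instance (H : SHS Loc Event n) : IsMarkovKernel H.jump := by
  refine ⟨fun s => ⟨?_⟩⟩
  change (∑ e, H.edgeProb s e • (H.reset e s.2).map (Prod.mk (H.tgt e)) : Measure H.State) univ = 1
  simp only [Measure.coe_finsetSum, Finset.sum_apply, Measure.smul_apply, smul_eq_mul,
    Measure.map_apply measurable_prodMk_left MeasurableSet.univ, preimage_univ, measure_univ,
    mul_one, H.sum_edgeProb]

section Kernel

variable [Finite Loc] [DiscreteMeasurableSpace Loc]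

theorem measurable_shift (H : SHS Loc Event n) : Measurable H.shift := by
  refine measurable_fst.fst.prodMk ?_
  have h : Measurable fun q : Loc × ((Fin n → ℝ) × ℝ≥0) => H.flow q.1 q.2 :=
    measurable_from_prod_countable_right fun ℓ => (H.continuous_flow ℓ).measurable
  exact h.comp (measurable_fst.fst.prodMk (measurable_fst.snd.prodMk measurable_snd))

/-- The STS of a stochastic hybrid system: from a state, a random delay elapses, then an edge
is chosen, then the valuation is reset. -/
noncomputable def kernel (H : SHS Loc Event n) : Kernel H.State H.State :=
  H.jump ∘ₖ ((Kernel.id ×ₖ H.delay).map H.shift)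

instance (H : SHS Loc Event n) : IsMarkovKernel H.kernel := by
  have : IsMarkovKernel ((Kernel.id ×ₖ H.delay).map H.shift) :=
    Kernel.IsMarkovKernel.map _ H.measurable_shift
  unfold kernel
  infer_instance

/-- The transition probabilities as an explicit integral. -/
theorem kernel_apply (H : SHS Loc Event n) (s : H.State) {A : Set H.State} (hA : MeasurableSet A) :
    H.kernel s A = ∫⁻ τ, ∑ e, H.edgeProb (H.shift (s, τ)) e *
      ∫⁻ w, A.indicator 1 (H.tgt e, w) ∂(H.reset e (H.flow s.1 (s.2, τ))) ∂(H.delay s) := by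
  have h1 : ∀ t : H.State, H.jump t A =
      ∑ e, H.edgeProb t e * ∫⁻ w, A.indicator 1 (H.tgt e, w) ∂(H.reset e t.2) := by
    intro t
    change (∑ e, H.edgeProb t e • (H.reset e t.2).map (Prod.mk (H.tgt e)) : Measure H.State) A = _
    simp only [Measure.coe_finsetSum, Finset.sum_apply, Measure.smul_apply, smul_eq_mul,
      Measure.map_apply measurable_prodMk_left hA]
    refine Finset.sum_congr rfl fun e _ => ?_
    rw [← lintegral_indicator_one (measurable_prodMk_left hA)]
    rfl
  rw [kernel, Kernel.comp_apply' _ _ _ hA, Kernel.lintegral_map _ H.measurable_shift _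
    (H.jump.measurable_coe hA), Kernel.lintegral_id_prod
    (f := fun p => H.jump (H.shift p) A) ((H.jump.measurable_coe hA).comp H.measurable_shift)]
  simp only [h1]
  rfl

end Kernel

/-- An edge is strongly reset if the law of the new valuation does not depend on the valuation
from which the edge is taken. -/
def StronglyReset (H : SHS Loc Event n) (e : H.edges) : Prop :=
  ∃ η : Measure (Fin n → ℝ), IsProbabilityMeasure η ∧ ∀ v ∈ H.guard e, H.reset e v = η

/-- Every cycle `c 0, …, c m` of the graph of locations and edges contains a strongly reset edge. -/
def CycleReset (H : SHS Loc Event n) : Prop :=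
  ∀ (m : ℕ) (c : ℕ → H.edges), (∀ i < m, H.tgt (c i) = H.src (c (i + 1))) →
    H.tgt (c m) = H.src (c 0) → ∃ i ≤ m, H.StronglyReset (c i)

/-- The initial partition of the procedure: the nonempty sets among the intersections of `B` and
of its complement with the sets of all states of one location. -/
def initPartition (H : SHS Loc Event n) (B : Set H.State) : Set (Set H.State) :=
  {P | P.Nonempty ∧ ∃ ℓ : Loc, P = B ∩ {s | s.1 = ℓ} ∨ P = Bᶜ ∩ {s | s.1 = ℓ}}

end SHS

namespace STS

/-! The edges that are not strongly reset form an acyclic graph on the finitely many locations,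
which allows induction along them (`CycleReset.wellFounded_weakStep`); a strongly reset edge forgets
the valuation from which it is taken. Decisiveness and termination both combine these two facts.

Decisiveness (`CycleReset.decisive`): let `D` be the complement of `C ∪ avoid C`. If, after a strong
reset, the run stayed in `D` with probability one for every number of steps, almost every new state
would avoid `C` and so lie outside `D`, which is absurd. Hence some finite number of steps has
staying probability below one. Induction carries this back through the other edges to a bound `c <
1` uniform in the state, and iteration gives geometric decay.

Termination (`CycleReset.exists_finite_cells`): what a strongly reset edge sees of a cell is either
nothing or independent of the cell; any other edge leads to a location where, by induction, only
finitely many cells occur in all executions. So the cells of each location lie in a finite Boolean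
algebra fixed in advance, while every iteration adds a cell.

An output is stable: whether `κ s` charges a union of cells depends only on the cell of `s`
(`IsQuotientChain.eq_zero_iff`). This gives the abstraction property. Soundness
(`isSound_of_forall_eq_zero_iff`) follows because avoiding a set almost surely is decided by null
sets: a run that almost surely reaches `A` in the abstraction cannot meet `avoid` before `A`, and
decisiveness forces it into `A`. -/

theorem compl_reach {S : Type*} (B : Set S) : (reach B)ᶜ = {ρ | ∀ k, ρ k ∈ Bᶜ} := by
  ext ρ
  simp [reach]

/-! ### Staying probabilities and the law of runs. -/

section Stay

variable {S : Type*} [MeasurableSpace S]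

instance (κ : Kernel S S) [IsMarkovKernel κ] (μ : Measure S) [IsProbabilityMeasure μ] :
    IsProbabilityMeasure (runLaw κ μ) := by
  unfold runLaw
  infer_instance

/-- The probability that a run from a state stays in `D` during the first `m` steps. -/
noncomputable def stay (κ : Kernel S S) (D : Set S) : ℕ → S → ℝ≥0∞
  | 0 => D.indicator 1
  | m + 1 => D.indicator fun s => ∫⁻ t, stay κ D m t ∂(κ s)

variable (κ : Kernel S S) {D D' : Set S}

theorem measurable_stay (hD : MeasurableSet D) (m : ℕ) : Measurable (stay κ D m) := by
  induction m with
  | zero => exact measurable_one.indicator hD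
  | succ m ih => exact ih.lintegral_kernel.indicator hD

theorem stay_succ_of_mem {s : S} (hs : s ∈ D) (m : ℕ) :
    stay κ D (m + 1) s = ∫⁻ t, stay κ D m t ∂(κ s) := indicator_of_mem hs _

theorem stay_of_notMem {s : S} (hs : s ∉ D) (m : ℕ) : stay κ D m s = 0 := by
  cases m <;> exact indicator_of_notMem hs _

theorem stay_mono (h : D ⊆ D') (m : ℕ) (s : S) : stay κ D m s ≤ stay κ D' m s := by
  induction m generalizing s with
  | zero => exact indicator_le_indicator_of_subset h (fun _ => zero_le) s
  | succ m ih =>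
    by_cases hs : s ∈ D
    · rw [stay_succ_of_mem κ hs, stay_succ_of_mem κ (h hs)]
      exact lintegral_mono ih
    · rw [stay_of_notMem κ hs]
      exact zero_le

variable [IsMarkovKernel κ]

theorem stay_le_one (m : ℕ) (s : S) : stay κ D m s ≤ 1 := by
  induction m generalizing s with
  | zero => exact indicator_le_self' (fun _ _ => zero_le) s
  | succ m ih =>
    refine (indicator_le_self' (fun _ _ => zero_le) s).trans ?_
    calc ∫⁻ t, stay κ D m t ∂(κ s) ≤ ∫⁻ _, 1 ∂(κ s) := lintegral_mono ih
      _ = 1 := by simp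

theorem stay_succ_le (m : ℕ) (s : S) : stay κ D (m + 1) s ≤ stay κ D m s := by
  by_cases hs : s ∈ D
  · induction m generalizing s with
    | zero =>
      refine (stay_le_one κ 1 s).trans ?_
      simp [stay, hs]
    | succ m ih =>
      rw [stay_succ_of_mem κ hs, stay_succ_of_mem κ hs]
      refine lintegral_mono fun t => ?_
      by_cases ht : t ∈ D
      · exact ih t ht
      · rw [stay_of_notMem κ ht]
        exact zero_le
  · rw [stay_of_notMem κ hs]
    exact zero_le

theorem antitone_stay : Antitone (stay κ D) :=
  antitone_nat_of_succ_le fun m s => stay_succ_le κ m s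

/-- By the Markov property, `M` further steps in `D` cost a factor of at most `c`, wherever they
start. -/
theorem stay_add_le {M : ℕ} {c : ℝ≥0∞} (h : ∀ s, stay κ D M s ≤ c) (m : ℕ) (s : S) :
    stay κ D (m + M) s ≤ c * stay κ D m s := by
  by_cases hs : s ∈ D
  · induction m generalizing s with
    | zero => simpa [stay, hs] using h s
    | succ m ih =>
      rw [Nat.add_right_comm, stay_succ_of_mem κ hs, stay_succ_of_mem κ hs]
      -- `D` need not be measurable, so `c` is moved into the integral by its finiteness; the
      -- infinite case is monotonicity.
      by_cases hc : c = ∞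
      · subst hc
        have h1 : ∀ t, stay κ D (m + M) t ≤ stay κ D m t :=
          fun t => antitone_stay κ (Nat.le_add_right m M) t
        exact (lintegral_mono h1).trans (le_mul_of_one_le_left zero_le le_top)
      · rw [← lintegral_const_mul' c _ hc]
        refine lintegral_mono fun t => ?_
        by_cases ht : t ∈ D
        · exact ih t ht
        · rw [stay_of_notMem κ ht]
          exact zero_le
  · rw [stay_of_notMem κ hs]
    exact zero_le

/-- If the probability of staying in `D` for some number of steps is bounded away from `1`, then
`D` is almost surely left. -/
theorem iInf_stay_eq_zero {M : ℕ} {c : ℝ≥0∞} (hc : c < 1) (h : ∀ s, stay κ D M s ≤ c) (s : S) :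
    ⨅ m, stay κ D m s = 0 := by
  have h1 : ∀ j : ℕ, stay κ D (j * M) s ≤ c ^ j := by
    intro j
    induction j with
    | zero => simpa using stay_le_one κ 0 s
    | succ j ih =>
      rw [Nat.succ_mul, pow_succ']
      exact (stay_add_le κ h _ s).trans (by gcongr)
  refine le_antisymm (ge_of_tendsto' (ENNReal.tendsto_pow_atTop_nhds_zero_of_lt_one hc)
    fun j => (iInf_le _ (j * M)).trans (h1 j)) zero_le

variable (μ : Measure S) [IsProbabilityMeasure μ]

/-- Since `stay` is at most one, an average of one leaves no loss off a null set. This makes almost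
sure staying a question about null sets only. -/
theorem lintegral_stay_eq_one_iff (m : ℕ) :
    ∫⁻ s, stay κ D m s ∂μ = 1 ↔ ∀ᵐ s ∂μ, stay κ D m s = 1 := by
  refine ⟨fun h => ?_, fun h => ?_⟩
  · refine ae_eq_of_ae_le_of_lintegral_le (g := fun _ => 1)
      (Filter.Eventually.of_forall (stay_le_one κ m)) ?_ aemeasurable_const ?_
    · simp [h]
    · simp [h]
  · rw [lintegral_congr_ae (g := fun _ => 1) h]
    simp

theorem runLaw_map_zero : (runLaw κ μ).map (fun ρ => ρ 0) = μ := by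
  have h : (fun ρ : ℕ → S => ρ 0) =
      (MeasurableEquiv.piUnique fun _ : Finset.Iic 0 => S) ∘ Preorder.frestrictLe 0 := rfl
  unfold runLaw Kernel.trajMeasure
  rw [h, ← Measure.map_map (by fun_prop) (by fun_prop), Measure.map_comp _ _ (by fun_prop),
    Kernel.traj_map_frestrictLe, Kernel.partialTraj_self, Measure.id_comp,
    MeasurableEquiv.map_map_symm]

/-- The Markov property at time `a`: given the prefix, the next state has law `κ (ρ a)`. The
constraint on `ρ a` moves from the domain of integration into the integrand. -/
theorem setLIntegral_runLaw_succ {g : S → ℝ≥0∞} (hg : Measurable g) (hD : MeasurableSet D)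
    (a : ℕ) : ∫⁻ ρ in {ρ | ∀ k < a + 1, ρ k ∈ D}, g (ρ (a + 1)) ∂(runLaw κ μ) =
      ∫⁻ ρ in {ρ | ∀ k < a, ρ k ∈ D}, D.indicator (fun s => ∫⁻ t, g t ∂(κ s)) (ρ a)
        ∂(runLaw κ μ) := by
  let κ' : (k : ℕ) → Kernel ((i : Finset.Iic k) → S) S := fun k =>
    κ.comap (fun x => x ⟨k, Finset.mem_Iic.2 le_rfl⟩) (measurable_pi_apply _)
  have hcp : (runLaw κ μ).map (Preorder.frestrictLe a) ⊗ₘ κ' a =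
      (runLaw κ μ).map (fun x => (Preorder.frestrictLe a x, x (a + 1))) :=
    Kernel.map_frestrictLe_trajMeasure_compProd_eq_map_trajMeasure (X := fun _ => S) (κ := κ')
  have hset : ∀ m, MeasurableSet {ρ : ℕ → S | ∀ k < m, ρ k ∈ D} := fun m => by
    simp only [ofPred_forall]
    exact MeasurableSet.iInter fun k => MeasurableSet.iInter fun _ => measurable_pi_apply k hD
  let W : Set ((i : Finset.Iic a) → S) := {x | ∀ i, x i ∈ D}
  have hW : MeasurableSet W := by
    simp only [W, ofPred_forall]
    exact MeasurableSet.iInter fun k => measurable_pi_apply k hD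
  have hmem : ∀ ρ : ℕ → S, Preorder.frestrictLe a ρ ∈ W ↔ ∀ k < a + 1, ρ k ∈ D := by
    intro ρ
    simp [W, Preorder.frestrictLe]
  let F : ((i : Finset.Iic a) → S) × S → ℝ≥0∞ := fun p => W.indicator 1 p.1 * g p.2
  have hF : Measurable F := ((measurable_one.indicator hW).comp measurable_fst).mul
    (hg.comp measurable_snd)
  have h1 : ∫⁻ ρ in {ρ | ∀ k < a + 1, ρ k ∈ D}, g (ρ (a + 1)) ∂(runLaw κ μ) =
      ∫⁻ p, F p ∂((runLaw κ μ).map (fun x => (Preorder.frestrictLe a x, x (a + 1)))) := by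
    rw [lintegral_map hF (by fun_prop), ← lintegral_indicator (hset _)]
    refine lintegral_congr fun ρ => ?_
    by_cases h : ∀ k < a + 1, ρ k ∈ D
    · rw [indicator_of_mem (by exact h)]
      simp only [F]
      rw [indicator_of_mem ((hmem ρ).2 h), Pi.one_apply, one_mul]
    · rw [indicator_of_notMem (by exact h)]
      simp only [F]
      rw [indicator_of_notMem (fun h' => h ((hmem ρ).1 h')), zero_mul]
  rw [h1, ← hcp, Measure.lintegral_compProd hF, lintegral_map hF.lintegral_kernel_prod_right'
    (by fun_prop), ← lintegral_indicator (hset _)]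
  refine lintegral_congr fun ρ => ?_
  have h2 : ∫⁻ t, F (Preorder.frestrictLe a ρ, t) ∂(κ' a (Preorder.frestrictLe a ρ)) =
      W.indicator 1 (Preorder.frestrictLe a ρ) * ∫⁻ t, g t ∂(κ (ρ a)) :=
    lintegral_const_mul (μ := κ (ρ a)) (W.indicator 1 (Preorder.frestrictLe a ρ)) hg
  rw [h2]
  have h3 : (∀ k < a + 1, ρ k ∈ D) ↔ (∀ k < a, ρ k ∈ D) ∧ ρ a ∈ D :=
    Nat.forall_lt_succ_right
  by_cases h : ∀ k < a, ρ k ∈ D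
  · rw [indicator_of_mem (s := {ρ : ℕ → S | ∀ k < a, ρ k ∈ D}) h]
    by_cases h' : ρ a ∈ D
    · rw [indicator_of_mem ((hmem ρ).2 (h3.2 ⟨h, h'⟩)), indicator_of_mem h', Pi.one_apply, one_mul]
    · rw [indicator_of_notMem (fun h4 => h' (h3.1 ((hmem ρ).1 h4)).2), indicator_of_notMem h',
        zero_mul]
  · rw [indicator_of_notMem (s := {ρ : ℕ → S | ∀ k < a, ρ k ∈ D}) h,
      indicator_of_notMem (fun h4 => h (h3.1 ((hmem ρ).1 h4)).1), zero_mul]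

theorem runLaw_forall_mem (hD : MeasurableSet D) (m : ℕ) :
    runLaw κ μ {ρ | ∀ k ≤ m, ρ k ∈ D} = ∫⁻ s, stay κ D m s ∂μ := by
  -- A general starting time `a` lets the induction on `m` transfer one step at a time from `stay`
  -- to the run; only `a = 0` is used.
  have h1 : ∀ m a, ∫⁻ ρ in {ρ | ∀ k < a, ρ k ∈ D}, stay κ D m (ρ a) ∂(runLaw κ μ) =
      ∫⁻ ρ in {ρ | ∀ k < a + m, ρ k ∈ D}, stay κ D 0 (ρ (a + m)) ∂(runLaw κ μ) := by
    intro m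
    induction m with
    | zero => simp
    | succ m ih =>
      intro a
      rw [← Nat.add_assoc, Nat.add_right_comm, ← ih (a + 1),
        setLIntegral_runLaw_succ κ μ (measurable_stay κ hD m) hD]
      rfl
  have h2 := h1 m 0
  have hset : ∀ m, MeasurableSet {ρ : ℕ → S | ∀ k < m, ρ k ∈ D} := fun m => by
    simp only [ofPred_forall]
    exact MeasurableSet.iInter fun k => MeasurableSet.iInter fun _ => measurable_pi_apply k hD
  simp only [not_lt_zero, false_implies, implies_true, ofPred_true, Measure.restrict_univ,
    zero_add] at h2
  rw [← lintegral_map (f := stay κ D m) (g := fun ρ : ℕ → S => ρ 0) (measurable_stay κ hD m)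
    (measurable_pi_apply 0), runLaw_map_zero] at h2
  have h3 : ∀ ρ : ℕ → S, (∀ k ≤ m, ρ k ∈ D) ↔ (∀ k < m, ρ k ∈ D) ∧ ρ m ∈ D := fun ρ => by
    simpa only [Nat.lt_succ_iff] using Nat.forall_lt_succ_right (n := m) (p := fun k => ρ k ∈ D)
  have h4 : (fun ρ : ℕ → S => stay κ D 0 (ρ m)) = {ρ | ρ m ∈ D}.indicator fun _ => 1 := rfl
  rw [h2, h4, setLIntegral_indicator, setLIntegral_one]
  · congr 1
    ext ρ
    rw [mem_ofPred_eq, h3, and_comm]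
    rfl
  · exact measurable_pi_apply m hD

theorem runLaw_forall_mem_all (hD : MeasurableSet D) :
    runLaw κ μ {ρ | ∀ k, ρ k ∈ D} = ∫⁻ s, ⨅ m, stay κ D m s ∂μ := by
  have hset : ∀ m, MeasurableSet {ρ : ℕ → S | ∀ k ≤ m, ρ k ∈ D} := fun m => by
    simp only [ofPred_forall]
    exact MeasurableSet.iInter fun k => MeasurableSet.iInter fun _ => measurable_pi_apply k hD
  have h1 : {ρ : ℕ → S | ∀ k, ρ k ∈ D} = ⋂ m, {ρ : ℕ → S | ∀ k ≤ m, ρ k ∈ D} := by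
    ext ρ
    simp only [mem_ofPred_eq, mem_iInter]
    exact ⟨fun h m k _ => h k, fun h k => h k k le_rfl⟩
  rw [h1, Antitone.measure_iInter, lintegral_iInf (measurable_stay κ hD) (antitone_stay κ)]
  · simp only [runLaw_forall_mem κ μ hD]
  · refine ((lintegral_mono (stay_le_one κ 0)).trans_lt ?_).ne
    simp
  · exact fun m m' h ρ hρ k hk => hρ k (hk.trans h)
  · exact fun m => (hset m).nullMeasurableSet
  · exact ⟨0, measure_ne_top _ _⟩

theorem measurableSet_reach {B : Set S} (hB : MeasurableSet B) : MeasurableSet (reach B) := by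
  simp only [reach, ofPred_exists]
  exact MeasurableSet.iUnion fun k => measurable_pi_apply k hB

theorem runLaw_reach_eq_one_iff {B : Set S} (hB : MeasurableSet B) :
    runLaw κ μ (reach B) = 1 ↔ ∀ᵐ s ∂μ, ⨅ m, stay κ Bᶜ m s = 0 := by
  rw [← prob_compl_eq_zero_iff (measurableSet_reach hB), compl_reach,
    runLaw_forall_mem_all κ μ hB.compl,
    lintegral_eq_zero_iff (Measurable.iInf (measurable_stay κ hB.compl))]
  rfl

/-- Continuity from above: never visiting `B` is the decreasing limit of not visiting it up to time
`m`. -/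
theorem mem_avoid_iff {B : Set S} (hB : MeasurableSet B) {s : S} :
    s ∈ avoid κ B ↔ ∀ m, stay κ Bᶜ m s = 1 := by
  unfold avoid
  rw [mem_ofPred_eq, ← prob_compl_eq_one_iff (measurableSet_reach hB), compl_reach,
    runLaw_forall_mem_all κ _ hB.compl,
    lintegral_dirac' _ (Measurable.iInf (measurable_stay κ hB.compl))]
  refine ⟨fun h m => (stay_le_one κ m s).antisymm (h.symm.le.trans (iInf_le _ m)), fun h => ?_⟩
  simp [h]

theorem measurableSet_avoid {B : Set S} (hB : MeasurableSet B) : MeasurableSet (avoid κ B) := by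
  have h : avoid κ B = ⋂ m, stay κ Bᶜ m ⁻¹' {1} := by
    ext s
    have := mem_avoid_iff κ hB (s := s)
    simpa using this
  rw [h]
  exact MeasurableSet.iInter fun m => measurable_stay κ hB.compl m (measurableSet_singleton 1)

end Stay
-- Abstraction and soundness from equality of null sets.
section Abstraction

variable {S₁ S₂ : Type*} [MeasurableSpace S₁] [MeasurableSpace S₂]
  {κ₁ : Kernel S₁ S₁} {κ₂ : Kernel S₂ S₂} {α : S₁ → S₂}

theorem isAbstraction_of_forall_eq_zero_iff (hα : Measurable α)
    (h : ∀ s A, MeasurableSet A → (κ₁ s (α ⁻¹' A) = 0 ↔ κ₂ (α s) A = 0)) :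
    IsAbstraction κ₁ κ₂ α := by
  refine ⟨hα, fun μ _ A hA => ?_⟩
  rw [pos_iff_ne_zero, pos_iff_ne_zero, not_iff_not, Measure.map_apply hα hA,
    Measure.bind_apply (hα hA) κ₁.aemeasurable, Measure.bind_apply hA κ₂.aemeasurable,
    lintegral_map (κ₂.measurable_coe hA) hα, lintegral_eq_zero_iff (κ₁.measurable_coe (hα hA)),
    lintegral_eq_zero_iff (f := fun s => κ₂ (α s) A) ((κ₂.measurable_coe hA).comp hα)]
  refine Filter.eventually_congr (Filter.Eventually.of_forall fun s => h s A hA)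

variable [IsMarkovKernel κ₁] [IsMarkovKernel κ₂]

/-- Staying `m + 1` steps surely means that the next state almost surely stays `m` steps surely, so
the recursion only sees null sets, on which both kernels agree. -/
theorem stay_preimage_eq_one_iff
    (h : ∀ s A, MeasurableSet A → (κ₁ s (α ⁻¹' A) = 0 ↔ κ₂ (α s) A = 0))
    {D : Set S₂} (hD : MeasurableSet D) (m : ℕ) (s : S₁) :
    stay κ₁ (α ⁻¹' D) m s = 1 ↔ stay κ₂ D m (α s) = 1 := by
  induction m generalizing s with
  | zero =>
    by_cases hs : α s ∈ D
    · simp [stay, hs]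
    · simp [stay, hs]
  | succ m ih =>
    by_cases hs : α s ∈ D
    · rw [stay_succ_of_mem κ₂ hs, stay_succ_of_mem κ₁ (s := s) (D := α ⁻¹' D) hs,
        lintegral_stay_eq_one_iff, lintegral_stay_eq_one_iff]
      simp only [ih]
      exact h s _ (measurable_stay κ₂ hD m (measurableSet_singleton 1)).compl
    · rw [stay_of_notMem κ₂ hs, stay_of_notMem κ₁ (s := s) (D := α ⁻¹' D) hs]

theorem isSound_of_forall_eq_zero_iff (hα : Measurable α)
    (h : ∀ s A, MeasurableSet A → (κ₁ s (α ⁻¹' A) = 0 ↔ κ₂ (α s) A = 0))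
    (hdec : ∀ A, MeasurableSet A → Decisive κ₁ (α ⁻¹' A)) : IsSound κ₁ κ₂ α := by
  rintro μ ν _ _ rfl A hA hreach
  have hA₁ := hα hA
  have hav := measurableSet_avoid κ₁ hA₁
  set Z := avoid κ₁ (α ⁻¹' A)
  set D := (α ⁻¹' A)ᶜ
  set D' := (α ⁻¹' A ∪ Z)ᶜ
  have hg := Measurable.iInf (measurable_stay κ₂ hA.compl)
  rw [runLaw_reach_eq_one_iff κ₂ _ hA, ae_map_iff hα.aemeasurable
    (p := fun q => ⨅ m, stay κ₂ Aᶜ m q = 0) (hg (measurableSet_singleton 0))] at hreach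
  rw [runLaw_reach_eq_one_iff κ₁ μ hA₁]
  set K := {q | ⨅ m, stay κ₂ Aᶜ m q = 0}
  have hK : MeasurableSet K := hg (measurableSet_singleton 0)
  -- from `K`, the set `A` is avoided with probability zero, and this property is preserved
  have hstep : ∀ s, α s ∈ K → s ∈ D → ∀ᵐ t ∂(κ₁ s), α t ∈ K := by
    intro s hs hsD
    have h0 : ∫⁻ q, ⨅ m, stay κ₂ Aᶜ m q ∂(κ₂ (α s)) = 0 := by
      rw [lintegral_iInf (measurable_stay κ₂ hA.compl) (antitone_stay κ₂)]
      · refine le_antisymm ?_ zero_le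
        rw [← show ⨅ m, stay κ₂ Aᶜ m (α s) = 0 from hs]
        refine le_iInf fun m => (iInf_le _ m).trans ?_
        exact (stay_succ_of_mem κ₂ (s := α s) (D := Aᶜ) hsD m).symm.le.trans
          (stay_succ_le κ₂ m _)
      · refine ((lintegral_mono (stay_le_one κ₂ 0)).trans_lt ?_).ne
        simp
    rw [lintegral_eq_zero_iff hg] at h0
    exact (h s Kᶜ hK.compl).2 h0
  have hZ : ∀ s, α s ∈ K → s ∉ Z := by
    intro s hs hsZ
    rw [mem_avoid_iff κ₁ hA₁] at hsZ
    have : ∀ m, stay κ₂ Aᶜ m (α s) = 1 := fun m =>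
      (stay_preimage_eq_one_iff h hA.compl m s).1 (hsZ m)
    have h1 : ⨅ m, stay κ₂ Aᶜ m (α s) = 0 := hs
    simp [this] at h1
  -- Before `A` is hit, a run from `K` almost surely remains over `K`, hence outside `Z`; removing
  -- `Z` from `D` therefore loses nothing.
  have heq : ∀ m s, α s ∈ K → stay κ₁ D m s ≤ stay κ₁ D' m s := by
    intro m
    induction m with
    | zero =>
      intro s hs
      by_cases hsD : s ∈ D
      · have : s ∈ D' := fun h' => h'.elim hsD (hZ s hs)
        simp [stay, this, hsD]
      · rw [stay_of_notMem κ₁ hsD]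
        exact zero_le
    | succ m ih =>
      intro s hs
      by_cases hsD : s ∈ D
      · have hD' : s ∈ D' := fun h' => h'.elim hsD (hZ s hs)
        rw [stay_succ_of_mem κ₁ hsD, stay_succ_of_mem κ₁ hD']
        exact lintegral_mono_ae ((hstep s hs hsD).mono ih)
      · rw [stay_of_notMem κ₁ hsD]
        exact zero_le
  filter_upwards [hreach] with s hs
  have hd := hdec A hA (Measure.dirac s)
  have hu : reach (α ⁻¹' A) ∪ reach Z = reach (α ⁻¹' A ∪ Z) := by
    ext ρ
    simp only [reach, mem_union, mem_ofPred_eq, exists_or]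
  rw [hu, runLaw_reach_eq_one_iff κ₁ _ (hA₁.union hav), ae_dirac_iff
    (p := fun t => ⨅ m, stay κ₁ (α ⁻¹' A ∪ Z)ᶜ m t = 0)
    (Measurable.iInf (measurable_stay κ₁ (hA₁.union hav).compl) (measurableSet_singleton 0))] at hd
  exact le_antisymm ((iInf_mono fun m => heq m s hs).trans hd.le) zero_le

end Abstraction

/-! ### Partition refinement in a general system. -/

section Refinement

variable {S : Type*} [MeasurableSpace S] {κ : Kernel S S} {𝒞₀ 𝒞 𝒟 : Set (Set S)}

theorem measurableSet_pre {A : Set S} (hA : MeasurableSet A) : MeasurableSet (pre κ A) :=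
  κ.measurable_coe hA measurableSet_Ioi

theorem RefineStep.forall_mem {p : Set S → Prop}
    (hp : ∀ P P', p P → p P' → p (P ∩ pre κ P') ∧ p (P \ pre κ P')) (h : RefineStep κ 𝒞 𝒟)
    (hC : ∀ P ∈ 𝒞, p P) : ∀ P ∈ 𝒟, p P := by
  obtain ⟨P, hP, P', hP', -, -, rfl⟩ := h
  have := hp P P' (hC P hP) (hC P' hP')
  rintro Q (⟨hQ, -⟩ | rfl | rfl)
  exacts [hC Q hQ, this.1, this.2]

theorem forall_mem_of_reflTransGen {p : Set S → Prop}
    (hp : ∀ P P', p P → p P' → p (P ∩ pre κ P') ∧ p (P \ pre κ P'))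
    (h : Relation.ReflTransGen (RefineStep κ) 𝒞₀ 𝒞) (hC : ∀ P ∈ 𝒞₀, p P) : ∀ P ∈ 𝒞, p P := by
  induction h with
  | refl => exact hC
  | tail _ hs ih => exact hs.forall_mem hp ih

theorem RefineStep.isPartition (h : RefineStep κ 𝒞 𝒟) (hC : Setoid.IsPartition 𝒞) :
    Setoid.IsPartition 𝒟 := by
  obtain ⟨P, hP, P', hP', h1, h2, rfl⟩ := h
  refine ⟨?_, fun a => ?_⟩
  · rintro (⟨h, -⟩ | h | h)
    · exact hC.1 h
    · exact h1.ne_empty h.symm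
    · exact h2.ne_empty h.symm
  · obtain ⟨Q, ⟨hQ, haQ⟩, huniq⟩ := hC.2 a
    have hne : ∀ R ∈ 𝒞, a ∈ R → R = Q := fun R hR haR => huniq R ⟨hR, haR⟩
    by_cases hQP : Q = P
    · subst hQP
      by_cases ha : a ∈ pre κ P'
      · refine ⟨Q ∩ pre κ P', ⟨Or.inr (Or.inl rfl), haQ, ha⟩, ?_⟩
        rintro R ⟨⟨hR, hRQ⟩ | rfl | rfl, haR⟩
        · exact absurd (hne R hR haR) hRQ
        · rfl
        · exact absurd ha haR.2
      · refine ⟨Q \ pre κ P', ⟨Or.inr (Or.inr rfl), haQ, ha⟩, ?_⟩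
        rintro R ⟨⟨hR, hRQ⟩ | rfl | rfl, haR⟩
        · exact absurd (hne R hR haR) hRQ
        · exact absurd haR.2 ha
        · rfl
    · refine ⟨Q, ⟨Or.inl ⟨hQ, hQP⟩, haQ⟩, ?_⟩
      rintro R ⟨⟨hR, hRQ⟩ | rfl | rfl, haR⟩
      · exact hne R hR haR
      · exact absurd (hne P hP haR.1).symm hQP
      · exact absurd (hne P hP haR.1).symm hQP

theorem isPartition_of_reflTransGen (h : Relation.ReflTransGen (RefineStep κ) 𝒞₀ 𝒞)
    (hC : Setoid.IsPartition 𝒞₀) : Setoid.IsPartition 𝒞 := by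
  induction h with
  | refl => exact hC
  | tail _ hs ih => exact hs.isPartition ih

/-- Neither part of `P` is an old cell, since it would meet `P` without being equal to it; so two
new cells replace one. -/
theorem RefineStep.ncard_lt (h : RefineStep κ 𝒞 𝒟) (hC : Setoid.IsPartition 𝒞)
    (hfin : 𝒞.Finite) : 𝒞.ncard < 𝒟.ncard := by
  obtain ⟨P, hP, P', hP', ⟨a, haP, ha⟩, ⟨b, hbP, hb⟩, rfl⟩ := h
  have h1 : P \ pre κ P' ∉ 𝒞 := fun h => by
    have := (hC.2 b).unique ⟨h, hbP, hb⟩ ⟨hP, hbP⟩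
    exact (this.symm ▸ haP : a ∈ P \ pre κ P').2 ha
  have h2 : P ∩ pre κ P' ∉ 𝒞 := fun h => by
    have := (hC.2 a).unique ⟨h, haP, ha⟩ ⟨hP, haP⟩
    exact hb (this.symm ▸ hbP : b ∈ P ∩ pre κ P').2
  have h3 : P ∩ pre κ P' ≠ P \ pre κ P' := fun h =>
    (h ▸ ⟨haP, ha⟩ : a ∈ P \ pre κ P').2 ha
  rw [ncard_union_eq _ (hfin.subset sdiff_subset) (by simp), ncard_pair h3]
  · have := ncard_sdiff_singleton_add_one hP hfin
    omega
  · rw [Set.disjoint_left]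
    rintro Q ⟨hQ, -⟩ (rfl | rfl)
    exacts [h2 hQ, h1 hQ]

/-- If only finitely many cells can occur, then the refinement procedure terminates. -/
theorem not_exists_infinite_refinement {F : Set (Set S)} (hF : F.Finite)
    (hC₀ : Setoid.IsPartition 𝒞₀)
    (hsub : ∀ 𝒞, Relation.ReflTransGen (RefineStep κ) 𝒞₀ 𝒞 → 𝒞 ⊆ F) :
    ¬ ∃ f : ℕ → Set (Set S), f 0 = 𝒞₀ ∧ ∀ k, RefineStep κ (f k) (f (k + 1)) := by
  rintro ⟨f, rfl, hf⟩
  have h1 : ∀ k, Relation.ReflTransGen (RefineStep κ) (f 0) (f k) := fun k => by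
    induction k with
    | zero => exact .refl
    | succ k ih => exact ih.tail (hf k)
  have h2 : ∀ k, k ≤ (f k).ncard := fun k => by
    induction k with
    | zero => exact Nat.zero_le _
    | succ k ih => exact ih.trans_lt ((hf k).ncard_lt (isPartition_of_reflTransGen (h1 k) hC₀)
        (hF.subset (hsub _ (h1 k))))
  exact absurd ((h2 (F.ncard + 1)).trans (ncard_le_ncard (hsub _ (h1 _)) hF)) (by omega)

theorem exists_isRefinementOutput {F : Set (Set S)} (hF : F.Finite)
    (hC₀ : Setoid.IsPartition 𝒞₀)
    (hsub : ∀ 𝒞, Relation.ReflTransGen (RefineStep κ) 𝒞₀ 𝒞 → 𝒞 ⊆ F) :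
    ∃ 𝒞, IsRefinementOutput κ 𝒞₀ 𝒞 := by
  by_contra! h
  have h1 : ∀ 𝒞 : {𝒞 // Relation.ReflTransGen (RefineStep κ) 𝒞₀ 𝒞},
      ∃ 𝒟 : {𝒞 // Relation.ReflTransGen (RefineStep κ) 𝒞₀ 𝒞}, RefineStep κ 𝒞.1 𝒟.1 := by
    rintro ⟨𝒞, h𝒞⟩
    have h2 : ∃ 𝒟, RefineStep κ 𝒞 𝒟 := by
      by_contra! h2
      exact h 𝒞 ⟨h𝒞, h2⟩
    obtain ⟨𝒟, h𝒟⟩ := h2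
    exact ⟨⟨𝒟, h𝒞.tail h𝒟⟩, h𝒟⟩
  choose g hg using h1
  refine not_exists_infinite_refinement hF hC₀ hsub
    ⟨fun k => (g^[k] ⟨𝒞₀, .refl⟩).1, rfl, fun k => ?_⟩
  simp only [Function.iterate_succ_apply']
  exact hg _

/-- A cell with states on both sides of `pre κ P'` would permit another iteration. -/
theorem IsRefinementOutput.subset_pre_iff (h : IsRefinementOutput κ 𝒞₀ 𝒞) {P P' : Set S}
    (hP : P ∈ 𝒞) (hP' : P' ∈ 𝒞) {s : S} (hs : s ∈ P) : P ⊆ pre κ P' ↔ s ∈ pre κ P' := by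
  refine ⟨fun h1 => h1 hs, fun h1 => ?_⟩
  by_contra h2
  obtain ⟨t, ht, ht'⟩ := not_subset.1 h2
  exact h.2 _ ⟨P, hP, P', hP', ⟨s, hs, h1⟩, ⟨t, ht, ht'⟩, rfl⟩

end Refinement

/-! ### Markov chains on the cells of an output. -/

section Quotient

variable {S : Type*} [MeasurableSpace S] {κ : Kernel S S} {𝒞₀ 𝒞 : Set (Set S)}
  {α : S → Cells 𝒞}

theorem preimage_singleton_of_isPartition {S : Type*} {𝒞 : Set (Set S)} {α : S → Cells 𝒞}
    (hα : ∀ s, s ∈ (α s).1) (hC : Setoid.IsPartition 𝒞) (P : Cells 𝒞) :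
    α ⁻¹' {P} = P.1 := by
  ext s
  refine ⟨?_, fun h => Subtype.ext ((hC.2 s).unique ⟨(α s).2, hα s⟩ ⟨P.2, h⟩)⟩
  rintro rfl
  exact hα s

theorem measurable_of_isPartition (hα : ∀ s, s ∈ (α s).1) 
    (hC : Setoid.IsPartition 𝒞) (hfin : 𝒞.Finite)
    (hmeas : ∀ P ∈ 𝒞, MeasurableSet P) : Measurable α := by
  have : Finite (Cells 𝒞) := hfin
  refine measurable_to_countable' fun P => ?_
  rw [preimage_singleton_of_isPartition hα hC]
  exact hmeas _ P.2

theorem isClosedUnder_of_forall_subset_or {S : Type*} {𝒞 : Set (Set S)} {α : S → Cells 𝒞}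
    (hα : ∀ s, s ∈ (α s).1)  {B : Set S}
    (hB : ∀ P ∈ 𝒞, P ⊆ B ∨ P ⊆ Bᶜ) : IsClosedUnder α B := by
  refine (subset_preimage_image α B).antisymm' ?_
  rintro s ⟨t, ht, hts⟩
  have : t ∈ (α s).1 := hts ▸ hα t
  exact (hB _ (α s).2).elim (fun h => h (hα s)) fun h => absurd ht (h this)

/-- Each cell moves like a chosen representative, with the next state replaced by its cell;
stability makes the support independent of the choice. -/
theorem exists_isQuotientChain [IsMarkovKernel κ] (hα : ∀ s, s ∈ (α s).1) 
    (h : IsRefinementOutput κ 𝒞₀ 𝒞) (hC : Setoid.IsPartition 𝒞) (hm : Measurable α) :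
    ∃ κ₂ : Kernel (Cells 𝒞) (Cells 𝒞), IsMarkovKernel κ₂ ∧ IsQuotientChain κ κ₂ := by
  have hne : ∀ P : Cells 𝒞, P.1.Nonempty := fun P => Setoid.nonempty_of_mem_partition hC P.2
  let r : Cells 𝒞 → S := fun P => (hne P).some
  have hr : ∀ P, r P ∈ P.1 := fun P => (hne P).some_mem
  have hr' : Measurable r := fun _ _ => trivial
  refine ⟨(κ.map α).comap r hr', ?_, fun P P' => ?_⟩
  · have := Kernel.IsMarkovKernel.map κ hm
    infer_instance
  · rw [Kernel.comap_apply' , Kernel.map_apply' _ hm _ (measurableSet_singleton P'),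
      preimage_singleton_of_isPartition hα hC, h.subset_pre_iff P.2 P'.2 (hr P)]
    rfl

/-- Stability settles single cells, and a finite union is null exactly when each of its cells is. -/
theorem IsQuotientChain.eq_zero_iff (hα : ∀ s, s ∈ (α s).1) 
    (h : IsRefinementOutput κ 𝒞₀ 𝒞)
    (hC : Setoid.IsPartition 𝒞) (hfin : 𝒞.Finite)
    {κ₂ : Kernel (Cells 𝒞) (Cells 𝒞)} (hκ : IsQuotientChain κ κ₂) (s : S) (A : Set (Cells 𝒞)) :
    κ s (α ⁻¹' A) = 0 ↔ κ₂ (α s) A = 0 := by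
  have : Finite (Cells 𝒞) := hfin
  have h1 : ∀ P : Cells 𝒞, κ s (α ⁻¹' {P}) = 0 ↔ κ₂ (α s) {P} = 0 := by
    intro P
    have := hκ (α s) P
    rw [h.subset_pre_iff (α s).2 P.2 (hα s)] at this
    rw [preimage_singleton_of_isPartition hα hC]
    simpa [pre, pos_iff_ne_zero] using (not_congr this).symm
  rw [← biUnion_of_singleton A, preimage_iUnion₂, measure_biUnion_null_iff A.to_countable,
    measure_biUnion_null_iff A.to_countable]
  simp only [h1]

end Quotient

end STS

/-! ### Finite Boolean algebras of sets. -/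

/-- The sets that are unions of atoms of the Boolean algebra generated by a family of sets. -/
def saturated {S : Type*} (G : Set (Set S)) : Set (Set S) :=
  {A | ∀ s t, (∀ g ∈ G, s ∈ g ↔ t ∈ g) → (s ∈ A ↔ t ∈ A)}

section Saturated

variable {S : Type*} {G : Set (Set S)} {A A' : Set S}

theorem subset_saturated : G ⊆ saturated G := fun g hg _ _ h => h g hg

theorem inter_mem_saturated (h : A ∈ saturated G) (h' : A' ∈ saturated G) :
    A ∩ A' ∈ saturated G := fun s t hst => and_congr (h s t hst) (h' s t hst)

theorem sdiff_mem_saturated (h : A ∈ saturated G) (h' : A' ∈ saturated G) :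
    A \ A' ∈ saturated G := fun s t hst => and_congr (h s t hst) (not_congr (h' s t hst))

theorem compl_mem_saturated (h : A ∈ saturated G) : Aᶜ ∈ saturated G :=
  fun s t hst => not_congr (h s t hst)

theorem empty_mem_saturated : ∅ ∈ saturated G := fun _ _ _ => Iff.rfl

theorem iUnion_mem_saturated {ι : Sort*} {f : ι → Set S} (h : ∀ i, f i ∈ saturated G) :
    ⋃ i, f i ∈ saturated G := fun s t hst => by
  simp only [mem_iUnion]
  exact exists_congr fun i => h i s t hst

/-- A saturated set is determined by the patterns of membership in `G` of its points, and there are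
finitely many patterns. -/
theorem finite_saturated (hG : G.Finite) : (saturated G).Finite := by
  let φ : S → Set (Set S) := fun s => {g ∈ G | s ∈ g}
  refine Finite.of_finite_image (f := fun A => φ '' A)
    (hG.finite_subsets.finite_subsets.subset ?_) ?_
  · rintro _ ⟨A, -, rfl⟩ _ ⟨s, -, rfl⟩
    exact sep_subset _ _
  · have key : ∀ A ∈ saturated G, ∀ A' ∈ saturated G, φ '' A = φ '' A' → A ⊆ A' := by
      intro A _ A' hA' h s hs
      obtain ⟨t, ht, hts⟩ : φ s ∈ φ '' A' := h ▸ mem_image_of_mem φ hs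
      refine (hA' t s fun g hg => ?_).1 ht
      have : g ∈ φ t ↔ g ∈ φ s := by rw [hts]
      simpa [φ, hg] using this
    exact fun A hA A' hA' h => (key A hA A' hA' h).antisymm (key A' hA' A hA h.symm)

end Saturated

/-! ### Acyclicity of the weak edges, and decisiveness. -/

namespace SHS

variable {Loc Event : Type*} [MeasurableSpace Loc] {n : ℕ} (H : SHS Loc Event n)

/-- Some edge that is not strongly reset leads from the second location to the first. -/
def WeakStep (ℓ' ℓ : Loc) : Prop := ∃ e, H.src e = ℓ ∧ H.tgt e = ℓ' ∧ ¬ H.StronglyReset e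

theorem exists_path_of_transGen_weakStep {ℓ ℓ' : Loc}
    (h : Relation.TransGen (Function.swap H.WeakStep) ℓ ℓ') :
    ∃ (m : ℕ) (c : ℕ → H.edges), (∀ i < m, H.tgt (c i) = H.src (c (i + 1))) ∧
      H.src (c 0) = ℓ ∧ H.tgt (c m) = ℓ' ∧ ∀ i ≤ m, ¬ H.StronglyReset (c i) := by
  induction h with
  | single h =>
    obtain ⟨e, h1, h2, h3⟩ := h
    exact ⟨0, fun _ => e, by simp, h1, h2, fun _ _ => h3⟩
  | tail _ h ih =>
    obtain ⟨e, h1, h2, h3⟩ := h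
    obtain ⟨m, c, hc, hc0, hcm, hw⟩ := ih
    refine ⟨m + 1, fun i => if i ≤ m then c i else e, fun i hi => ?_, by simpa using hc0,
      by simpa using h2, fun i hi => ?_⟩
    · rcases (Nat.lt_succ_iff.1 hi).lt_or_eq with h | rfl
      · simpa [h.le, h] using hc i h
      · simp [hcm, h1]
    · dsimp only
      split_ifs with h
      exacts [hw i h, h3]

variable {H}

/-- A cycle of weak edges would contradict cycle-resetness, and an irreflexive transitive relation
on a finite type is well-founded. The induction hypothesis concerns the targets of weak edges. -/
theorem CycleReset.wellFounded_weakStep [Finite Loc] (hH : H.CycleReset) :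
    WellFounded H.WeakStep := by
  have : Std.Irrefl (Relation.TransGen H.WeakStep) := ⟨fun ℓ h => by
    obtain ⟨m, c, hc, hc0, hcm, hw⟩ :=
      H.exists_path_of_transGen_weakStep (Relation.transGen_swap.2 h)
    obtain ⟨i, hi, hi'⟩ := hH m c hc (hcm.trans hc0.symm)
    exact hw i hi hi'⟩
  exact WellFounded.mono (Finite.wellFounded_of_trans_of_irrefl (Relation.TransGen H.WeakStep))
    fun _ _ => Relation.TransGen.single

variable (H)

theorem ae_enabled (s : H.State) : ∀ᵐ τ ∂(H.delay s), ∀ e : H.edges,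
    0 < H.edgeProb (H.shift (s, τ)) e ↔ H.src e = s.1 ∧ H.flow s.1 (s.2, τ) ∈ H.guard e := by
  filter_upwards [H.delay_mem s] with τ hτ
  exact H.edgeProb_pos_iff (H.shift (s, τ)) (hτ.1 τ le_rfl) hτ.2

theorem lintegral_jump {f : H.State → ℝ≥0∞} (hf : Measurable f) (s : H.State) :
    ∫⁻ t, f t ∂(H.jump s) =
      ∑ e, H.edgeProb s e * ∫⁻ w, f (H.tgt e, w) ∂(H.reset e s.2) := by
  change ∫⁻ t, f t ∂(∑ e, H.edgeProb s e • (H.reset e s.2).map (Prod.mk (H.tgt e))) = _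
  rw [lintegral_finsetSum_measure]
  refine Finset.sum_congr rfl fun e _ => ?_
  rw [lintegral_smul_measure, lintegral_map hf measurable_prodMk_left, smul_eq_mul]

variable [Finite Loc] [DiscreteMeasurableSpace Loc]

theorem lintegral_kernel {f : H.State → ℝ≥0∞} (hf : Measurable f) (s : H.State) :
    ∫⁻ t, f t ∂(H.kernel s) = ∫⁻ τ, ∑ e, H.edgeProb (H.shift (s, τ)) e *
      ∫⁻ w, f (H.tgt e, w) ∂(H.reset e (H.flow s.1 (s.2, τ))) ∂(H.delay s) := by
  rw [kernel, Kernel.lintegral_comp _ _ _ hf, Kernel.lintegral_map _ H.measurable_shift _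
    hf.lintegral_kernel, Kernel.lintegral_id_prod
    (f := fun p => ∫⁻ t, f t ∂(H.jump (H.shift p)))
    (hf.lintegral_kernel.comp H.measurable_shift)]
  simp only [H.lintegral_jump hf]
  rfl

/-- A bound for the resets by the enabled edges is a bound for the kernel. -/
theorem lintegral_kernel_le {f : H.State → ℝ≥0∞} (hf : Measurable f) (s : H.State) {c : ℝ≥0∞}
    (h : ∀ e, H.src e = s.1 → ∀ v ∈ H.guard e, ∫⁻ w, f (H.tgt e, w) ∂(H.reset e v) ≤ c) :
    ∫⁻ t, f t ∂(H.kernel s) ≤ c := by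
  rw [H.lintegral_kernel hf]
  calc _ ≤ ∫⁻ _, c ∂(H.delay s) := by
        refine lintegral_mono_ae ?_
        filter_upwards [H.ae_enabled s] with τ hτ
        calc _ ≤ ∑ e, H.edgeProb (H.shift (s, τ)) e * c := by
              refine Finset.sum_le_sum fun e _ => ?_
              rcases eq_or_ne (H.edgeProb (H.shift (s, τ)) e) 0 with h0 | h0
              · simp [h0]
              · obtain ⟨h1, h2⟩ := (hτ e).1 (pos_iff_ne_zero.2 h0)
                gcongr
                exact h e h1 _ h2
          _ = c := by rw [← Finset.sum_mul, H.sum_edgeProb, one_mul]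
    _ = c := by simp

open STS

/-- A cycle-reset stochastic hybrid system is decisive. -/
theorem CycleReset.decisive {H : SHS Loc Event n} (hH : H.CycleReset) {C : Set H.State}
    (hC : MeasurableSet C) : Decisive H.kernel C := by
  intro μ _
  have hav := measurableSet_avoid H.kernel hC
  set Z := avoid H.kernel C
  have hu : reach C ∪ reach Z = reach (C ∪ Z) := by
    ext ρ
    simp only [reach, mem_union, mem_ofPred_eq, exists_or]
  have hCZ := hC.union hav
  rw [hu, runLaw_reach_eq_one_iff _ _ hCZ]
  set f := stay H.kernel (C ∪ Z)ᶜ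
  have hf : ∀ m, Measurable (f m) := measurable_stay _ hCZ.compl
  have hanti : Antitone f := antitone_stay _
  have hstrong : ∀ e, H.StronglyReset e → ∃ (m : ℕ) (c : ℝ≥0∞), c < 1 ∧
      ∀ v ∈ H.guard e, ∫⁻ w, f m (H.tgt e, w) ∂(H.reset e v) ≤ c := by
    rintro e ⟨η, _, hη⟩
    obtain ⟨m, hm⟩ : ∃ m, ∫⁻ w, f m (H.tgt e, w) ∂η < 1 := by
      by_contra! h
      have : IsProbabilityMeasure (η.map (Prod.mk (H.tgt e))) :=
        Measure.isProbabilityMeasure_map measurable_prodMk_left.aemeasurable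
      have h1 : ∀ m, ∀ᵐ s ∂(η.map (Prod.mk (H.tgt e))), f m s = 1 := fun m => by
        rw [← lintegral_stay_eq_one_iff, lintegral_map (hf m) measurable_prodMk_left]
        refine le_antisymm ?_ (h m)
        refine (lintegral_mono fun w => stay_le_one H.kernel m (H.tgt e, w)).trans ?_
        simp
      obtain ⟨s, hs⟩ := (ae_all_iff.2 h1).exists
      -- Staying outside `C ∪ Z` surely forces staying outside `C` surely, so `s` is in `Z`; yet `f
      -- 0 s = 1` puts it outside `Z`.
      have hsZ : s ∈ Z := (mem_avoid_iff _ hC).2 fun m => le_antisymm (stay_le_one _ m s)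
        ((hs m).symm.le.trans (stay_mono _ (compl_subset_compl.2 subset_union_left) m s))
      have h2 : f 0 s = 0 := stay_of_notMem _ (not_not.2 (Or.inr hsZ)) 0
      rw [hs 0] at h2
      exact one_ne_zero h2
    exact ⟨m, _, hm, fun v hv => by rw [hη v hv]⟩
  have hloc : ∀ ℓ, ∃ (m : ℕ) (c : ℝ≥0∞), c < 1 ∧ ∀ v, f m (ℓ, v) ≤ c := by
    intro ℓ
    induction ℓ using hH.wellFounded_weakStep.induction with
    | _ ℓ ih =>
    have hedge : ∀ e, ∃ (m : ℕ) (c : ℝ≥0∞), c < 1 ∧ (H.src e = ℓ →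
        ∀ v ∈ H.guard e, ∫⁻ w, f m (H.tgt e, w) ∂(H.reset e v) ≤ c) := by
      intro e
      by_cases he : H.src e = ℓ
      · by_cases hs : H.StronglyReset e
        · obtain ⟨m, c, hc, h⟩ := hstrong e hs
          exact ⟨m, c, hc, fun _ => h⟩
        · obtain ⟨m, c, hc, h⟩ := ih (H.tgt e) ⟨e, he, rfl, hs⟩
          refine ⟨m, c, hc, fun _ v _ => ?_⟩
          refine (lintegral_mono fun w => h w).trans ?_
          simp
      · exact ⟨0, 0, zero_lt_one, fun h => absurd h he⟩
    choose m c hc h using hedge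
    -- One extra step for taking the edge; the largest `m e` serves all edges because `f` is
    -- antitone.
    refine ⟨Finset.univ.sup m + 1, Finset.univ.sup c, (Finset.sup_lt_iff zero_lt_one).2
      fun e _ => hc e, fun v => ?_⟩
    refine (indicator_le_self' (fun _ _ => zero_le) _).trans ?_
    refine H.lintegral_kernel_le (hf _) _ fun e he v hv => ?_
    refine (lintegral_mono fun w => ?_).trans
      ((h e he v hv).trans (Finset.le_sup (Finset.mem_univ e)))
    exact hanti (Finset.le_sup (Finset.mem_univ e)) _
  choose m c hc h using hloc
  have := Fintype.ofFinite Loc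
  refine Filter.Eventually.of_forall fun s => iInf_stay_eq_zero H.kernel
    (M := Finset.univ.sup m) (c := Finset.univ.sup c)
    ((Finset.sup_lt_iff zero_lt_one).2 fun e _ => hc e) (fun t => ?_) s
  exact (hanti (Finset.le_sup (Finset.mem_univ t.1)) t).trans
    ((h t.1 t.2).trans (Finset.le_sup (Finset.mem_univ t.1)))

end SHS

/-! ### Finiteness of the set of possible cells. -/

namespace SHS

open STS

variable {Loc Event : Type*} [MeasurableSpace Loc] {n : ℕ} (H : SHS Loc Event n)

/-- The set of states with a positive probability to be in `A` after one step that takes the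
edge `e`. -/
def edgePre (e : H.edges) (A : Set H.State) : Set H.State :=
  {s | ¬ ∀ᵐ τ ∂(H.delay s), H.edgeProb (H.shift (s, τ)) e = 0 ∨
    H.reset e (H.flow s.1 (s.2, τ)) (Prod.mk (H.tgt e) ⁻¹' A) = 0}

variable {H}

theorem src_eq_of_mem_edgePre {e : H.edges} {A : Set H.State} {s : H.State}
    (hs : s ∈ H.edgePre e A) : H.src e = s.1 := by
  by_contra h
  refine hs ?_
  filter_upwards [H.ae_enabled s] with τ hτ
  left
  by_contra h0
  exact h ((hτ e).1 (pos_iff_ne_zero.2 h0)).1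

theorem edgePre_eq_empty_of_subset {e : H.edges} {A : Set H.State} {ℓ : Loc}
    (hA : A ⊆ {s | s.1 = ℓ}) (he : H.tgt e ≠ ℓ) : H.edgePre e A = ∅ := by
  have h : Prod.mk (H.tgt e) ⁻¹' A = ∅ := by
    ext w
    simp only [mem_preimage, mem_empty_iff_false, iff_false]
    exact fun hw => he (hA hw)
  simp [edgePre, h]

/-- Whether the reset charges the slice of `A` does not depend on the state; if it does, only the
chance of taking `e` matters. -/
theorem StronglyReset.edgePre_eq {e : H.edges} (he : H.StronglyReset e) (A : Set H.State) :
    H.edgePre e A = ∅ ∨ H.edgePre e A = H.edgePre e univ := by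
  obtain ⟨η, _, hη⟩ := he
  have key : ∀ A' s, s ∈ H.edgePre e A' ↔ ¬ ∀ᵐ τ ∂(H.delay s),
      H.edgeProb (H.shift (s, τ)) e = 0 ∨ η (Prod.mk (H.tgt e) ⁻¹' A') = 0 := by
    intro A' s
    refine not_congr (Filter.eventually_congr ?_)
    filter_upwards [H.ae_enabled s] with τ hτ
    by_cases h0 : H.edgeProb (H.shift (s, τ)) e = 0
    · simp [h0]
    · rw [hη _ ((hτ e).1 (pos_iff_ne_zero.2 h0)).2]
  by_cases h0 : η (Prod.mk (H.tgt e) ⁻¹' A) = 0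
  · left
    ext s
    simp [key, h0]
  · right
    ext s
    simp [key, h0]

theorem initPartition_isPartition (B : Set H.State) : Setoid.IsPartition (H.initPartition B) := by
  refine ⟨fun h => h.1.ne_empty rfl, fun s => ?_⟩
  by_cases hs : s ∈ B
  · refine ⟨B ∩ {t | t.1 = s.1}, ⟨⟨⟨s, hs, rfl⟩, s.1, Or.inl rfl⟩, hs, rfl⟩, ?_⟩
    rintro P ⟨⟨-, ℓ, rfl | rfl⟩, h, rfl⟩
    · rfl
    · exact absurd hs h
  · refine ⟨Bᶜ ∩ {t | t.1 = s.1}, ⟨⟨⟨s, hs, rfl⟩, s.1, Or.inr rfl⟩, hs, rfl⟩, ?_⟩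
    rintro P ⟨⟨-, ℓ, rfl | rfl⟩, h, rfl⟩
    · exact absurd h hs
    · rfl

variable {B : Set H.State}

theorem subset_location_of_refinement {𝒞 : Set (Set H.State)}
    (h : Relation.ReflTransGen (RefineStep H.kernel) (H.initPartition B) 𝒞) :
    ∀ P ∈ 𝒞, ∃ ℓ, P ⊆ {s | s.1 = ℓ} := by
  refine forall_mem_of_reflTransGen (fun P P' ⟨ℓ, hP⟩ _ =>
    ⟨⟨ℓ, inter_subset_left.trans hP⟩, ⟨ℓ, sdiff_subset.trans hP⟩⟩) h ?_
  rintro P ⟨-, ℓ, rfl | rfl⟩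
  exacts [⟨ℓ, inter_subset_right⟩, ⟨ℓ, inter_subset_right⟩]

theorem subset_or_subset_compl_of_refinement {𝒞 : Set (Set H.State)}
    (h : Relation.ReflTransGen (RefineStep H.kernel) (H.initPartition B) 𝒞) :
    ∀ P ∈ 𝒞, P ⊆ B ∨ P ⊆ Bᶜ := by
  refine forall_mem_of_reflTransGen (fun P P' hP _ =>
    ⟨hP.imp inter_subset_left.trans inter_subset_left.trans,
      hP.imp sdiff_subset.trans sdiff_subset.trans⟩) h ?_
  rintro P ⟨-, ℓ, rfl | rfl⟩
  exacts [Or.inl inter_subset_left, Or.inr inter_subset_left]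

variable (H) [Finite Loc] [DiscreteMeasurableSpace Loc]

/-- The kernel is an integral of a finite sum of nonnegative terms, null exactly when every edge's
term vanishes almost everywhere. -/
theorem mem_pre_kernel_iff {A : Set H.State} (hA : MeasurableSet A) (s : H.State) :
    s ∈ pre H.kernel A ↔ ∃ e, s ∈ H.edgePre e A := by
  have hsl : ∀ e, MeasurableSet (Prod.mk (H.tgt e) ⁻¹' A : Set (Fin n → ℝ)) :=
    fun e => measurable_prodMk_left hA
  have h1 : H.kernel s A = ∫⁻ τ, ∑ e, H.edgeProb (H.shift (s, τ)) e *
      H.reset e (H.flow s.1 (s.2, τ)) (Prod.mk (H.tgt e) ⁻¹' A) ∂(H.delay s) := by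
    rw [H.kernel_apply s hA]
    refine lintegral_congr fun τ => Finset.sum_congr rfl fun e _ => ?_
    rw [← lintegral_indicator_one (hsl e)]
    rfl
  have hm : Measurable fun τ : ℝ≥0 => (s, τ) := measurable_prodMk_left
  have h2 : H.kernel s A = 0 ↔ ∀ e, s ∉ H.edgePre e A := by
    rw [h1, lintegral_eq_zero_iff]
    · simp only [edgePre, mem_ofPred_eq, not_not, ← ae_all_iff]
      refine Filter.eventually_congr (Filter.Eventually.of_forall fun τ => ?_)
      simp
    · refine Finset.measurable_sum _ fun e _ => ((H.measurable_edgeProb e).comp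
        (H.measurable_shift.comp hm)).mul (((H.reset e).measurable_coe (hsl e)).comp ?_)
      exact measurable_snd.comp (H.measurable_shift.comp hm)
  simp only [pre, mem_ofPred_eq, pos_iff_ne_zero, ne_eq, h2, not_forall, not_not]

variable {H}

theorem measurableSet_of_refinement (hB : MeasurableSet B) {𝒞 : Set (Set H.State)}
    (h : Relation.ReflTransGen (RefineStep H.kernel) (H.initPartition B) 𝒞) :
    ∀ P ∈ 𝒞, MeasurableSet P := by
  refine forall_mem_of_reflTransGen (fun P P' hP hP' =>
    ⟨hP.inter (measurableSet_pre hP'), hP.diff (measurableSet_pre hP')⟩) h ?_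
  have hℓ : ∀ ℓ, MeasurableSet {s : H.State | s.1 = ℓ} :=
    fun ℓ => measurable_fst (measurableSet_singleton ℓ)
  rintro P ⟨-, ℓ, rfl | rfl⟩
  exacts [hB.inter (hℓ ℓ), hB.compl.inter (hℓ ℓ)]

/-- In every location, only finitely many cells can occur during the refinement procedure. -/
theorem CycleReset.exists_finite_cells_location (hH : H.CycleReset) (hB : MeasurableSet B)
    (ℓ : Loc) : ∃ F : Set (Set H.State), F.Finite ∧ ∀ 𝒞,
      Relation.ReflTransGen (RefineStep H.kernel) (H.initPartition B) 𝒞 →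
        ∀ P ∈ 𝒞, P ⊆ {s | s.1 = ℓ} → P ∈ F := by
  induction ℓ using hH.wellFounded_weakStep.induction with
  | _ ℓ ih =>
  have hedge : ∀ e, ∃ F : Set (Set H.State), F.Finite ∧ (H.src e = ℓ → ¬ H.StronglyReset e →
      ∀ 𝒞, Relation.ReflTransGen (RefineStep H.kernel) (H.initPartition B) 𝒞 →
        ∀ P ∈ 𝒞, P ⊆ {s | s.1 = H.tgt e} → P ∈ F) := by
    intro e
    by_cases he : H.src e = ℓ ∧ ¬ H.StronglyReset e
    · obtain ⟨F, hF, h⟩ := ih (H.tgt e) ⟨e, he.1, rfl, he.2⟩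
      exact ⟨F, hF, fun _ _ => h⟩
    · exact ⟨∅, finite_empty, fun h1 h2 => absurd ⟨h1, h2⟩ he⟩
  choose F hF h using hedge
  -- Everything that can ever cut a cell of `ℓ`: the initial sets, the strong-reset predecessors,
  -- and the predecessors through weak edges of the finitely many cells of their targets. None
  -- depends on the execution.
  let G : Set (Set H.State) := {B, {s | s.1 = ℓ}} ∪ range (fun e => H.edgePre e univ) ∪
    ⋃ e, H.edgePre e '' F e
  have hG : G.Finite := ((toFinite _).union (finite_range _)).union
    (finite_iUnion fun e => (hF e).image _)
  have hGB : B ∈ saturated G := subset_saturated (Or.inl (Or.inl (Or.inl rfl)))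
  have hGℓ : {s : H.State | s.1 = ℓ} ∈ saturated G :=
    subset_saturated (Or.inl (Or.inl (Or.inr rfl)))
  refine ⟨saturated G, finite_saturated hG, fun 𝒞 h𝒞 => ?_⟩
  induction h𝒞 with
  | refl =>
    rintro P ⟨⟨s, hs⟩, ℓ', hP⟩ hPℓ
    obtain rfl : ℓ' = ℓ := by
      have h1 : s.1 = ℓ := hPℓ hs
      rcases hP with rfl | rfl
      exacts [hs.2.symm.trans h1, hs.2.symm.trans h1]
    rcases hP with rfl | rfl
    exacts [inter_mem_saturated hGB hGℓ, inter_mem_saturated (compl_mem_saturated hGB) hGℓ]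
  | tail h𝒞 hstep ih𝒞 =>
    obtain ⟨P, hP, P', hP', h1, h2, rfl⟩ := hstep
    -- The part is known to lie in `ℓ`; being nonempty, it places its parent `P` there too, so that
    -- the hypothesis applies to `P`.
    have hPℓ : ∀ Q ⊆ P, Q.Nonempty → Q ⊆ {s | s.1 = ℓ} → P ⊆ {s | s.1 = ℓ} := by
      rintro Q hQP ⟨s, hs⟩ hQ
      obtain ⟨ℓ₂, hℓ₂⟩ := subset_location_of_refinement h𝒞 P hP
      obtain rfl : ℓ₂ = ℓ := (hℓ₂ (hQP hs)).symm.trans (hQ hs)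
      exact hℓ₂
    obtain ⟨ℓ', hℓ'⟩ := subset_location_of_refinement h𝒞 P' hP'
    -- Inside `ℓ`, `pre H.kernel P'` coincides with `U`, although globally it need not be saturated.
    let U := ⋃ e, ⋃ _ : H.src e = ℓ, H.edgePre e P'
    have hU : U ∈ saturated G := by
      refine iUnion_mem_saturated fun e => iUnion_mem_saturated fun he => ?_
      by_cases hte : H.tgt e = ℓ'
      · subst hte
        by_cases hs : H.StronglyReset e
        · rcases hs.edgePre_eq P' with h' | h'
          · rw [h']
            exact empty_mem_saturated
          · rw [h']
            exact subset_saturated (Or.inl (Or.inr ⟨e, rfl⟩))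
        · exact subset_saturated (Or.inr (mem_iUnion.2
            ⟨e, mem_image_of_mem _ (h e he hs _ h𝒞 P' hP' hℓ')⟩))
      · rw [edgePre_eq_empty_of_subset hℓ' hte]
        exact empty_mem_saturated
    have hpre : ∀ s : H.State, s.1 = ℓ → (s ∈ pre H.kernel P' ↔ s ∈ U) := by
      intro s hs
      rw [H.mem_pre_kernel_iff (measurableSet_of_refinement hB h𝒞 P' hP')]
      simp only [U, mem_iUnion]
      exact exists_congr fun e => ⟨fun h => ⟨(src_eq_of_mem_edgePre h).trans hs, h⟩, fun h => h.2⟩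
    rintro Q (⟨hQ, -⟩ | rfl | rfl) hQℓ
    · exact ih𝒞 Q hQ hQℓ
    · have hP'' := hPℓ _ inter_subset_left h1 hQℓ
      have : P ∩ pre H.kernel P' = P ∩ U := by
        ext s
        exact and_congr_right fun hs => hpre s (hP'' hs)
      rw [this]
      exact inter_mem_saturated (ih𝒞 P hP hP'') hU
    · have hP'' := hPℓ _ sdiff_subset h2 hQℓ
      have : P \ pre H.kernel P' = P \ U := by
        ext s
        exact and_congr_right fun hs => not_congr (hpre s (hP'' hs))
      rw [this]
      exact sdiff_mem_saturated (ih𝒞 P hP hP'') hU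

theorem CycleReset.exists_finite_cells (hH : H.CycleReset) (hB : MeasurableSet B) :
    ∃ F : Set (Set H.State), F.Finite ∧ ∀ 𝒞,
      Relation.ReflTransGen (RefineStep H.kernel) (H.initPartition B) 𝒞 → 𝒞 ⊆ F := by
  choose F hF h using hH.exists_finite_cells_location hB
  refine ⟨⋃ ℓ, F ℓ, finite_iUnion hF, fun 𝒞 h𝒞 P hP => ?_⟩
  obtain ⟨ℓ, hℓ⟩ := subset_location_of_refinement h𝒞 P hP
  exact mem_iUnion.2 ⟨ℓ, h ℓ 𝒞 h𝒞 P hP hℓ⟩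

end SHS

/-- Let `H` be a cycle-reset stochastic hybrid system and `B` a measurable set of states. Then `H` is
decisive with respect to every measurable set of states; the partition-refinement procedure started
on the initial partition given by the locations and `B` terminates, whatever the choices made; and
the partition that it outputs is a finite measurable one whose cells, with any transition
probabilities that have the support prescribed by the procedure (and some do), form a sound
`α`-abstraction of `H` compatible with `B`, where `α` maps a state to its cell. -/
theorem mainTheorem4 {Loc Event : Type*} [Finite Loc] [MeasurableSpace Loc]
    [DiscreteMeasurableSpace Loc] {n : ℕ} (H : SHS Loc Event n) (hH : H.CycleReset)
    (B : Set H.State) (hB : MeasurableSet B) :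
    (∀ C : Set H.State, MeasurableSet C → STS.Decisive H.kernel C) ∧
    (¬ ∃ f : ℕ → Set (Set H.State), f 0 = H.initPartition B ∧
      ∀ k, STS.RefineStep H.kernel (f k) (f (k + 1))) ∧
    (∃ 𝒞, STS.IsRefinementOutput H.kernel (H.initPartition B) 𝒞) ∧
    ∀ 𝒞, STS.IsRefinementOutput H.kernel (H.initPartition B) 𝒞 →
      𝒞.Finite ∧ Setoid.IsPartition 𝒞 ∧ (∀ P ∈ 𝒞, MeasurableSet P) ∧
      ∃ α : H.State → STS.Cells 𝒞, (∀ s, s ∈ (α s).1) ∧ STS.IsClosedUnder α B ∧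
        (∃ κ₂ : Kernel (STS.Cells 𝒞) (STS.Cells 𝒞), IsMarkovKernel κ₂ ∧
          STS.IsQuotientChain H.kernel κ₂) ∧
        ∀ (κ₂ : Kernel (STS.Cells 𝒞) (STS.Cells 𝒞)) [IsMarkovKernel κ₂],
          STS.IsQuotientChain H.kernel κ₂ →
            STS.IsAbstraction H.kernel κ₂ α ∧ STS.IsSound H.kernel κ₂ α := by
  obtain ⟨F, hF, hsub⟩ := hH.exists_finite_cells hB
  have hinit := SHS.initPartition_isPartition B
  refine ⟨fun C hC => hH.decisive hC, STS.not_exists_infinite_refinement hF hinit hsub,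
    STS.exists_isRefinementOutput hF hinit hsub, fun 𝒞 h𝒞 => ?_⟩
  have hfin : 𝒞.Finite := hF.subset (hsub 𝒞 h𝒞.1)
  have hpart := STS.isPartition_of_reflTransGen h𝒞.1 hinit
  have hmeas := SHS.measurableSet_of_refinement hB h𝒞.1
  choose α₀ hα₀ using fun s => (hpart.2 s).exists
  let α : H.State → STS.Cells 𝒞 := fun s => ⟨α₀ s, (hα₀ s).1⟩
  have hα : ∀ s, s ∈ (α s).1 := fun s => (hα₀ s).2
  have hαm := STS.measurable_of_isPartition hα hpart hfin hmeas
  refine ⟨hfin, hpart, hmeas, α, hα, STS.isClosedUnder_of_forall_subset_or hα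
    (SHS.subset_or_subset_compl_of_refinement h𝒞.1),
    STS.exists_isQuotientChain hα h𝒞 hpart hαm, fun κ₂ _ hκ₂ => ?_⟩
  have hzero := STS.IsQuotientChain.eq_zero_iff hα h𝒞 hpart hfin hκ₂
  exact ⟨STS.isAbstraction_of_forall_eq_zero_iff hαm fun s A _ => hzero s A,
    STS.isSound_of_forall_eq_zero_iff hαm (fun s A _ => hzero s A)
      -- Soundness concerns every set of cells, so decisiveness is needed for all unions of cells
      -- and not only for `B`.
      fun A hA => hH.decisive (hαm hA)⟩
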